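/- Write $\mathbb D=\{z\in\mathbb C:|z|<1\}$ and $\|g\|_\infty=\sup_{z\in\mathbb D}|g(z)|$. Let $b_0,b_1,\dots$ be the (real) Taylor coefficients at $0$ of $\sqrt{1+z+z^2}$, so that $\sqrt{1+z+z^2}=\sum_{k=0}^\infty b_kz^k$ for $z\in\mathbb D$ (principal branch), and let $T_n(z)=\sum_{k=0}^n b_kz^k$. Let $n\ge 2$ be an integer. For every power series $f(z)=\sum_{k=0}^\infty a_kz^k$ converging in $\mathbb D$ with $\|f\|_\infty\le 1$, the segment $S_{n-2,n}(z)=a_{n-2}z^{n-2}+a_{n-1}z^{n-1}+a_nz^n$ satisfies $$\|S_{n-2,n}\|_\infty\le\sum_{k=0}^n b_k^2<\frac13+\frac{2\sqrt3}{\pi}.$$ Moreover, $T_n$ has no zeros in $\mathbb D$, the function $f(z)=z^nT_n(1/z)/T_n(z)$ (where $z^nT_n(1/z)$ denotes the polynomial $\sum_{k=0}^n b_kz^{n-k}$) is a finite Blaschke product, so $\|f\|_\infty\le1$, and equality holds in the first inequality for this $f$. -/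

import Mathlib

noncomputable section

open Metric
open scoped ENNReal

/-- The coefficient `b_k` of `x ^ k` in the Taylor series at `0` of `√(1 + x + x²)`.
The function is real on the real line, so its Taylor coefficients are real numbers. -/
def sqrtTrinomialCoeff (k : ℕ) : ℝ :=
  iteratedDeriv k (fun x : ℝ => Real.sqrt (1 + x + x ^ 2)) 0 / (k.factorial : ℝ)

/-- The Taylor polynomial `T_n(z) = ∑_{k=0}^n b_k z ^ k`, as a function on `ℂ`. -/
def sqrtTrinomialPoly (n : ℕ) (z : ℂ) : ℂ :=
  ∑ k ∈ Finset.range (n + 1), (sqrtTrinomialCoeff k : ℂ) * z ^ k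

/-- `f(z) = ∑_{k≥0} a_k z ^ k` for all `z` in the open unit disk. -/
def HasPowerSeriesOnDisk (f : ℂ → ℂ) (a : ℕ → ℂ) : Prop :=
  ∀ z ∈ ball (0 : ℂ) 1, HasSum (fun k : ℕ => a k * z ^ k) (f z)

/-- The segment `S_{m,n}(z) = ∑_{k=m}^n a_k z ^ k` of a power series. -/
def seriesSegment (a : ℕ → ℂ) (m n : ℕ) (z : ℂ) : ℂ :=
  ∑ k ∈ Finset.Icc m n, a k * z ^ k

/-- `‖g‖_∞`, the supremum of `|g|` over the open unit disk, as an extended nonnegative real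
(so that it is `∞` when `g` is unbounded). -/
def diskSupNorm (g : ℂ → ℂ) : ℝ≥0∞ :=
  ⨆ z ∈ ball (0 : ℂ) 1, ‖g z‖ₑ

/-- On the unit disk, `f` is a finite Blaschke product
`c ∏_{i} (z - α_i) / (1 - conj α_i * z)`, with `|c| = 1` and all `α_i` in the unit disk. -/
def IsFiniteBlaschkeProduct (f : ℂ → ℂ) : Prop :=
  ∃ (d : ℕ) (c : ℂ) (α : Fin d → ℂ), ‖c‖ = 1 ∧ (∀ i, α i ∈ ball (0 : ℂ) 1) ∧
    ∀ z ∈ ball (0 : ℂ) 1,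
      f z = c * ∏ i, (z - α i) / (1 - (starRingEnd ℂ) (α i) * z)

/-- The function `z ^ n T_n(1/z) / T_n(z)`. The numerator is written as the polynomial
`∑_{k=0}^n b_k z ^ (n - k)`, so that the value at `z = 0` is the right one. -/
def extremalQuotient (n : ℕ) (z : ℂ) : ℂ :=
  (∑ k ∈ Finset.range (n + 1), (sqrtTrinomialCoeff k : ℂ) * z ^ (n - k)) /
    sqrtTrinomialPoly n z

theorem extremalQuotient_of_ne_zero (n : ℕ) {z : ℂ} (hz : z ≠ 0) :
    extremalQuotient n z = z ^ n * sqrtTrinomialPoly n (1 / z) / sqrtTrinomialPoly n z := by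
  unfold extremalQuotient
  congr 1
  rw [sqrtTrinomialPoly, Finset.mul_sum]
  refine Finset.sum_congr rfl fun k hk => ?_
  have hkn : k ≤ n := Nat.lt_succ_iff.mp (Finset.mem_range.mp hk)
  rw [pow_sub₀ z hz hkn, one_div, inv_pow]
  ring

end

/-!
Write `p = 1 + z + z²` and `√p = ∑ b_k z ^ k`, and let `T_n` be the `n`-th partial sum.

*The bound.* Up to order `n` the series of `T_n²` agrees with `p`, so the coefficient of `z ^ n` in
`f T_n²` is `a_{n-2} + a_{n-1} + a_n`. As a Fourier coefficient on the unit circle it is at most the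
mean of `|f| |T_n|²`, hence at most the mean of `|T_n|²`, which is `∑_{k ≤ n} b_k²` by Parseval
(`norm_seriesSegment_one_le`). Replacing `f` by `f(ζ z)` with `|ζ| < 1` gives the bound at the
point `ζ`, and makes the series converge absolutely on the unit circle.

*The constant.* The `b_k` are absolutely summable, so on the unit circle `|T_N|²` tends boundedly
to `|p| = |1 + 2 cos t|`, whose mean is `1 / 3 + 2 √3 / π`. The inequality is strict because
`b_{3j+2} > 0` for every `j` (`sum_sqrtTrinomialCoeff_sq_lt`).

*Absence of zeros.* Consider `T_n(z) √(1 - z)`. It has constant term `1`, and its coefficients add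
up to its value `0` at `1`. If all the coefficients of positive index are nonpositive, their
absolute values add up to `1`, so that `|T_n(z) √(1 - z) - 1| ≤ |z| < 1` in the disk and `T_n` does
not vanish there (`sqrtTrinomialPoly_ne_zero`). Up to order `n` the coefficients are those of
`√p √(1 - z) = √(1 - z³)`, which have the right sign. The later ones are, up to sign, the sums
`∑_{k ≤ n} b_k |s_{m-k}|` with `m > n`, where `√(1 - z) = ∑ s_i z ^ i`. The differential equation of
`√p` gives a three-term recurrence for `b_k`, hence the signs `b_{3j+1} ≥ 0`, `b_{3j+2} > 0`,
`b_{3j+3} ≤ 0`, so only `n = 3j` matters. For fixed `m` the sums with `n = 3j` first increase and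
then decrease in `j`, so they are bounded below by the first one, `|s_m|`, or by the last one with
`3j < m`. The last one is computed from `√p √(1 - z) = √(1 - z³)`, and is nonnegative by an upper
bound for the `b_k` in terms of the `s_i` (`sqrtTrinomialCoeff_block_le`).

*The extremal function.* The polynomial `z ^ n T_n(1 / z)` is monic of degree `n` with real
coefficients and has all its roots in the closed disk, so `f = z ^ n T_n(1 / z) / T_n(z)` is a
product of factors `(z - α) / (1 - conj α z)`. From `f T_n² = z ^ n T_n(1 / z) T_n(z)`, the
coefficient of `z ^ n` shows that the segment of `f` takes the value `∑_{k ≤ n} b_k²` at `1`.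
-/

open Metric Filter Topology PowerSeries MeasureTheory

/-! ### Power series on the unit disk -/

theorem hasSum_coeff_mul {𝕜 : Type*} [RCLike 𝕜] {A B : PowerSeries 𝕜} {z u v : 𝕜}
    (hA : HasSum (fun k => coeff k A * z ^ k) u) (hB : HasSum (fun k => coeff k B * z ^ k) v) :
    HasSum (fun k => coeff k (A * B) * z ^ k) (u * v) := by
  have hA' := hA.summable.norm
  have hB' := hB.summable.norm
  have key : ∀ k, coeff k (A * B) * z ^ k =
      ∑ ij ∈ Finset.HasAntidiagonal.antidiagonal k,
        (coeff ij.1 A * z ^ ij.1) * (coeff ij.2 B * z ^ ij.2) := by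
    intro k
    rw [coeff_mul, Finset.sum_mul]
    refine Finset.sum_congr rfl fun ij hij => ?_
    rw [← Finset.HasAntidiagonal.mem_antidiagonal.mp hij, pow_add]
    ring
  have hs := (summable_norm_sum_mul_antidiagonal_of_summable_norm hA' hB').of_norm
  have ht := tsum_mul_tsum_eq_tsum_sum_antidiagonal_of_summable_norm hA' hB'
  rw [hA.tsum_eq, hB.tsum_eq] at ht
  simp_rw [key]
  rw [ht]
  exact hs.hasSum

theorem HasPowerSeriesOnDisk.mul {f g : ℂ → ℂ} {A B : PowerSeries ℂ}
    (hf : HasPowerSeriesOnDisk f (fun k => coeff k A))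
    (hg : HasPowerSeriesOnDisk g (fun k => coeff k B)) :
    HasPowerSeriesOnDisk (fun z => f z * g z) (fun k => coeff k (A * B)) :=
  fun z hz => hasSum_coeff_mul (hf z hz) (hg z hz)

theorem HasPowerSeriesOnDisk.unique {f : ℂ → ℂ} {a b : ℕ → ℂ}
    (ha : HasPowerSeriesOnDisk f a) (hb : HasPowerSeriesOnDisk f b) : a = b := by
  have aux : ∀ c : ℕ → ℂ, HasPowerSeriesOnDisk f c →
      HasFPowerSeriesAt f (FormalMultilinearSeries.ofScalars ℂ c) 0 := by
    intro c hc
    rw [hasFPowerSeriesAt_iff']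
    filter_upwards [ball_mem_nhds (0 : ℂ) one_pos] with z hz
    simpa [FormalMultilinearSeries.coeff_ofScalars, mul_comm] using hc z hz
  have h := (aux a ha).eq_formalMultilinearSeries (aux b hb)
  funext k
  simpa [FormalMultilinearSeries.coeff_ofScalars] using
    congrArg (fun p => FormalMultilinearSeries.coeff p k) h

theorem hasPowerSeriesOnDisk_taylor {f : ℂ → ℂ} (hf : DifferentiableOn ℂ f (ball 0 1)) :
    HasPowerSeriesOnDisk f (fun k => iteratedDeriv k f 0 / (k.factorial : ℂ)) := by
  intro z hz
  refine (Complex.hasSum_taylorSeries_on_ball hf hz).congr_fun ?_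
  intro k
  simp only [sub_zero, smul_eq_mul]
  ring

/-! ### The Taylor coefficients of `√(1 + z + z²)` -/

theorem one_add_add_sq_mem_slitPlane {z : ℂ} (hz : z ∈ ball (0 : ℂ) 1) :
    1 + z + z ^ 2 ∈ Complex.slitPlane := by
  rw [mem_ball_zero_iff] at hz
  have h2 : z.re ^ 2 + z.im ^ 2 < 1 := by
    have h := Complex.sq_norm z
    rw [Complex.normSq_apply] at h
    nlinarith [norm_nonneg z]
  rw [Complex.mem_slitPlane_iff]
  by_contra! h
  simp only [Complex.add_re, Complex.one_re, Complex.add_im, Complex.one_im, pow_two,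
    Complex.mul_re, Complex.mul_im] at h
  obtain ⟨h3, h4⟩ := h
  have h5 : z.im * (1 + 2 * z.re) = 0 := by linarith
  rcases mul_eq_zero.mp h5 with h6 | h6
  · rw [h6] at h3
    nlinarith [sq_nonneg (z.re + 1 / 2)]
  · have : z.re = -1 / 2 := by linarith
    rw [this] at h3 h2
    nlinarith

theorem differentiableOn_sqrt_trinomial :
    DifferentiableOn ℂ (fun z : ℂ => (1 + z + z ^ 2) ^ (1 / 2 : ℂ)) (ball 0 1) := by
  intro z hz
  exact (DifferentiableAt.cpow (f := fun z : ℂ => 1 + z + z ^ 2) (by fun_prop) (by fun_prop)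
    (one_add_add_sq_mem_slitPlane hz)).differentiableWithinAt

/-- If a holomorphic function is real on the real diameter of the disk, then so are its iterated
derivatives, and they are the iterated derivatives of its restriction. -/
theorem iteratedDeriv_ofReal_of_forall_eq {f : ℂ → ℂ} {φ : ℝ → ℝ}
    (hf : DifferentiableOn ℂ f (ball 0 1)) (h : ∀ x ∈ ball (0 : ℝ) 1, f x = φ x) (k : ℕ) :
    ∀ x ∈ ball (0 : ℝ) 1, iteratedDeriv k f x = (iteratedDeriv k φ x : ℝ) := by
  induction k with
  | zero => simpa using h
  | succ k ih =>
    intro x hx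
    have hxc : (x : ℂ) ∈ ball (0 : ℂ) 1 := by simpa using hx
    have hd : DifferentiableAt ℂ (iteratedDeriv k f) x := by
      have := (hf.analyticOnNhd isOpen_ball).iterated_deriv k
      rw [← iteratedDeriv_eq_iterate] at this
      exact (this x hxc).differentiableAt
    have hev : ∀ᶠ y : ℝ in 𝓝 x, iteratedDeriv k f (y : ℂ) = (iteratedDeriv k φ y : ℝ) := by
      filter_upwards [isOpen_ball.mem_nhds hx] with y hy using ih y hy
    have h1 := hd.hasDerivAt.comp_ofReal
    have h2 : HasDerivAt (iteratedDeriv k φ) (deriv (iteratedDeriv k f) x).re x := by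
      refine hd.hasDerivAt.real_of_complex.congr_of_eventuallyEq ?_
      filter_upwards [hev] with y hy
      rw [hy, Complex.ofReal_re]
    have h3 := h2.ofReal_comp.congr_of_eventuallyEq hev
    rw [iteratedDeriv_succ, iteratedDeriv_succ, h2.deriv]
    exact h1.unique h3

theorem hasPowerSeriesOnDisk_sqrt_trinomial :
    HasPowerSeriesOnDisk (fun z : ℂ => (1 + z + z ^ 2) ^ (1 / 2 : ℂ))
      (fun k : ℕ => (sqrtTrinomialCoeff k : ℂ)) := by
  have h := hasPowerSeriesOnDisk_taylor differentiableOn_sqrt_trinomial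
  convert! h using 2 with k
  have := iteratedDeriv_ofReal_of_forall_eq (φ := fun x : ℝ => Real.sqrt (1 + x + x ^ 2))
    differentiableOn_sqrt_trinomial (fun x _ => ?_) k 0 (by simp)
  · rw [Complex.ofReal_zero] at this
    rw [this, sqrtTrinomialCoeff]
    push_cast
    rfl
  · have h0 : 0 ≤ 1 + x + x ^ 2 := by nlinarith [sq_nonneg (x + 1 / 2)]
    rw [Real.sqrt_eq_rpow, Complex.ofReal_cpow h0]
    push_cast
    rfl

/-- The Taylor series of `√(1 + x + x²)` as a formal power series. -/
noncomputable def sqrtTrinomialSeries : PowerSeries ℝ := PowerSeries.mk sqrtTrinomialCoeff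

theorem sqrtTrinomialSeries_sq : sqrtTrinomialSeries ^ 2 = 1 + X + X ^ 2 := by
  have h := hasPowerSeriesOnDisk_sqrt_trinomial
  set A : PowerSeries ℂ := PowerSeries.map Complex.ofRealHom sqrtTrinomialSeries with hA
  have hc : (fun k : ℕ => (sqrtTrinomialCoeff k : ℂ)) = fun k => coeff k A := by
    funext k; simp [hA, sqrtTrinomialSeries]
  rw [hc] at h
  have h2 := h.mul h
  have h3 : HasPowerSeriesOnDisk (fun z : ℂ => (1 + z + z ^ 2) ^ (1 / 2 : ℂ) *
      (1 + z + z ^ 2) ^ (1 / 2 : ℂ)) (fun k => coeff k (1 + X + X ^ 2 : PowerSeries ℂ)) := by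
    intro z hz
    have hne : 1 + z + z ^ 2 ≠ 0 := Complex.slitPlane_ne_zero (one_add_add_sq_mem_slitPlane hz)
    simp only [← Complex.cpow_add _ _ hne]
    have := hasSum_sum_of_ne_finset_zero (L := .unconditional ℕ) (s := Finset.range 3)
      (f := fun k => coeff k (1 + X + X ^ 2 : PowerSeries ℂ) * z ^ k) (fun k hk => by
        have : 3 ≤ k := by simpa using hk
        simp [coeff_one, coeff_X, coeff_X_pow, show k ≠ 0 by omega, show k ≠ 1 by omega,
          show k ≠ 2 by omega])
    convert! this using 1
    norm_num [Finset.sum_range_succ, coeff_one, coeff_X, coeff_X_pow]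
  have h4 := h2.unique h3
  have h5 : A * A = 1 + X + X ^ 2 := PowerSeries.ext fun k => congrFun h4 k
  apply PowerSeries.map_injective Complex.ofRealHom Complex.ofReal_injective
  rw [map_pow, ← hA, pow_two, h5]
  simp

theorem sqrtTrinomialCoeff_zero : sqrtTrinomialCoeff 0 = 1 := by
  simp [sqrtTrinomialCoeff]

/-- The recurrence expressing the differential equation `2 p g' = p' g` of `g = √p`,
where `p = 1 + z + z²`. -/
theorem sqrtTrinomialCoeff_add_two (k : ℕ) :
    2 * (k + 2 : ℝ) * sqrtTrinomialCoeff (k + 2) =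
      -(2 * k + 1) * sqrtTrinomialCoeff (k + 1) + (2 - 2 * k) * sqrtTrinomialCoeff k := by
  set B := sqrtTrinomialSeries with hB
  have hsq : B ^ 2 = 1 + X + X ^ 2 := sqrtTrinomialSeries_sq
  have hB0 : B ≠ 0 := by
    intro h
    have := congrArg (coeff 0) h
    simp [hB, sqrtTrinomialSeries, sqrtTrinomialCoeff_zero] at this
  have hd : 2 * B * d⁄dX ℝ B = 1 + 2 * X := by
    have := congrArg (d⁄dX ℝ) hsq
    simpa [derivative_pow, mul_comm, mul_assoc, mul_left_comm] using this
  have hode : C (2 : ℝ) * ((1 + X + X ^ 2) * d⁄dX ℝ B) = (1 + C 2 * X) * B := by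
    have h2 : (C (2 : ℝ) : PowerSeries ℝ) = 2 := map_ofNat C 2
    rw [← hsq, h2, ← hd]; ring
  have hc := congrArg (coeff (k + 1)) hode
  cases k with
  | zero =>
    simp [add_mul, mul_assoc, coeff_derivative, coeff_succ_X_mul, pow_two, hB,
      sqrtTrinomialSeries, coeff_zero_X_mul] at hc
    norm_num at hc ⊢
    linarith
  | succ k =>
    simp [add_mul, mul_assoc, coeff_derivative, coeff_succ_X_mul, pow_two, hB,
      sqrtTrinomialSeries] at hc
    push_cast
    norm_num [add_assoc] at hc ⊢
    linarith

theorem sqrtTrinomialCoeff_one : sqrtTrinomialCoeff 1 = 1 / 2 := by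
  have h := congrArg (coeff 1) sqrtTrinomialSeries_sq
  simp [pow_two, coeff_mul, Finset.Nat.antidiagonal_succ,
    sqrtTrinomialSeries, sqrtTrinomialCoeff_zero, coeff_one, coeff_X] at h
  linarith

/-! ### Signs and sizes of the coefficients -/

theorem sqrtTrinomialCoeff_two : sqrtTrinomialCoeff 2 = 3 / 8 := by
  have h := sqrtTrinomialCoeff_add_two 0
  norm_num [sqrtTrinomialCoeff_zero, sqrtTrinomialCoeff_one] at h
  linarith

theorem sqrtTrinomialCoeff_three_mul_add_three (j : ℕ) :
    sqrtTrinomialCoeff (3 * j + 3) = -((2 * j + 1) * sqrtTrinomialCoeff (3 * j + 2) +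
      2 * j * sqrtTrinomialCoeff (3 * j + 1)) / (2 * j + 2) := by
  have h := sqrtTrinomialCoeff_add_two (3 * j + 1)
  push_cast at h
  rw [eq_div_iff (by positivity)]
  linear_combination h / 3

theorem sqrtTrinomialCoeff_three_mul_add_four (j : ℕ) :
    sqrtTrinomialCoeff (3 * j + 4) = (3 * sqrtTrinomialCoeff (3 * j + 2) +
      6 * j * (6 * j + 5) * sqrtTrinomialCoeff (3 * j + 1)) / ((6 * j + 6) * (6 * j + 8)) := by
  have h := sqrtTrinomialCoeff_add_two (3 * j + 2)
  have h3 := sqrtTrinomialCoeff_three_mul_add_three j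
  push_cast at h
  rw [eq_div_iff (by positivity)] at h3 ⊢
  linear_combination (6 * j + 6 : ℝ) * h - 3 * (6 * j + 5 : ℝ) * h3

theorem sqrtTrinomialCoeff_three_mul_add_five (j : ℕ) :
    sqrtTrinomialCoeff (3 * j + 5) =
      ((216 * j ^ 3 + 540 * j ^ 2 + 390 * j + 75) * sqrtTrinomialCoeff (3 * j + 2) -
        18 * j * sqrtTrinomialCoeff (3 * j + 1)) / ((6 * j + 6) * (6 * j + 8) * (6 * j + 10)) := by
  have h := sqrtTrinomialCoeff_add_two (3 * j + 3)
  have h3 := sqrtTrinomialCoeff_three_mul_add_three j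
  have h4 := sqrtTrinomialCoeff_three_mul_add_four j
  push_cast at h
  rw [eq_div_iff (by positivity)] at h3 h4 ⊢
  linear_combination (6 * j + 6 : ℝ) * (6 * j + 8) * h - (6 * j + 7 : ℝ) * h4
    - 3 * (6 * j + 8 : ℝ) * (6 * j + 4) * h3

/-- The sign pattern of the coefficients of index not divisible by three; the inequality between
consecutive coefficients is what carries the induction. -/
theorem sqrtTrinomialCoeff_sign (j : ℕ) :
    0 ≤ sqrtTrinomialCoeff (3 * j + 1) ∧ 0 < sqrtTrinomialCoeff (3 * j + 2) ∧
      sqrtTrinomialCoeff (3 * j + 1) ≤ 2 * sqrtTrinomialCoeff (3 * j + 2) := by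
  induction j with
  | zero => norm_num [sqrtTrinomialCoeff_one, sqrtTrinomialCoeff_two]
  | succ j ih =>
    obtain ⟨hu, hv, huv⟩ := ih
    have h4 := sqrtTrinomialCoeff_three_mul_add_four j
    have h5 := sqrtTrinomialCoeff_three_mul_add_five j
    rw [show 3 * (j + 1) + 1 = 3 * j + 4 by ring, show 3 * (j + 1) + 2 = 3 * j + 5 by ring]
    set u := sqrtTrinomialCoeff (3 * j + 1)
    set v := sqrtTrinomialCoeff (3 * j + 2)
    have hj : (0 : ℝ) ≤ j := j.cast_nonneg
    have hju : (j : ℝ) * u ≤ j * (2 * v) := mul_le_mul_of_nonneg_left huv hj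
    have hjv : 0 ≤ (j : ℝ) * v := by positivity
    have hj2u : (j : ℝ) ^ 2 * u ≤ j ^ 2 * (2 * v) := mul_le_mul_of_nonneg_left huv (by positivity)
    have hj3u : (j : ℝ) ^ 3 * u ≤ j ^ 3 * (2 * v) := mul_le_mul_of_nonneg_left huv (by positivity)
    have hj2v : 0 ≤ (j : ℝ) ^ 2 * v := by positivity
    have hj3v : 0 ≤ (j : ℝ) ^ 3 * v := by positivity
    refine ⟨h4 ▸ by positivity, ?_, ?_⟩
    · rw [h5]
      apply div_pos _ (by positivity)
      nlinarith
    · rw [h4, h5, ← mul_div_assoc, div_le_div_iff₀ (by positivity) (by positivity)]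
      have : (3 * v + 6 * j * (6 * j + 5) * u) * (6 * j + 10) ≤
          2 * ((216 * j ^ 3 + 540 * j ^ 2 + 390 * j + 75) * v - 18 * j * u) := by
        nlinarith
      have hp : (0 : ℝ) ≤ (6 * j + 6) * (6 * j + 8) := by positivity
      nlinarith [mul_le_mul_of_nonneg_right this hp]

theorem sqrtTrinomialCoeff_three_mul_add_three_nonpos (j : ℕ) :
    sqrtTrinomialCoeff (3 * j + 3) ≤ 0 := by
  obtain ⟨hu, hv, -⟩ := sqrtTrinomialCoeff_sign j
  rw [sqrtTrinomialCoeff_three_mul_add_three, neg_div, neg_nonpos]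
  positivity

/-! ### The series of `√(1 - z)` -/

/-- Minus the coefficient of `z ^ (l + 1)` in the Taylor series of `√(1 - z)` at `0`. -/
noncomputable def oneSubSqrtCoeff : ℕ → ℝ
  | 0 => 1 / 2
  | l + 1 => oneSubSqrtCoeff l * ((2 * l + 1) / (2 * l + 4))

theorem oneSubSqrtCoeff_pos (l : ℕ) : 0 < oneSubSqrtCoeff l := by
  induction l with
  | zero => norm_num [oneSubSqrtCoeff]
  | succ l ih => rw [oneSubSqrtCoeff]; positivity

theorem sum_range_oneSubSqrtCoeff (N : ℕ) :
    ∑ l ∈ Finset.range N, oneSubSqrtCoeff l = 1 - 2 * (N + 1) * oneSubSqrtCoeff N := by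
  induction N with
  | zero => norm_num [oneSubSqrtCoeff]
  | succ N ih =>
    rw [Finset.sum_range_succ, ih, oneSubSqrtCoeff]
    push_cast
    field_simp
    ring

theorem summable_oneSubSqrtCoeff : Summable oneSubSqrtCoeff := by
  refine summable_of_sum_range_le (c := 1) (fun l => (oneSubSqrtCoeff_pos l).le) fun N => ?_
  rw [sum_range_oneSubSqrtCoeff]
  have := oneSubSqrtCoeff_pos N
  nlinarith [mul_nonneg (N.cast_nonneg : (0 : ℝ) ≤ N) this.le]

/-- The Taylor series of `√(1 - x)` as a formal power series. -/
noncomputable def oneSubSqrtSeries : PowerSeries ℝ := 1 - X * PowerSeries.mk oneSubSqrtCoeff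

theorem coeff_zero_oneSubSqrtSeries : coeff 0 oneSubSqrtSeries = 1 := by
  simp [oneSubSqrtSeries]

theorem coeff_succ_oneSubSqrtSeries (l : ℕ) :
    coeff (l + 1) oneSubSqrtSeries = -oneSubSqrtCoeff l := by
  simp [oneSubSqrtSeries, coeff_succ_X_mul, coeff_one]

theorem oneSubSqrtSeries_sq : oneSubSqrtSeries ^ 2 = 1 - X := by
  set S := oneSubSqrtSeries with hS
  -- the definition of the coefficients is the differential equation of `√(1 - x)`
  have hode : 2 * ((1 - X) * d⁄dX ℝ S) = -S := by
    ext l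
    rw [show (2 : PowerSeries ℝ) = C 2 from (map_ofNat C 2).symm, coeff_C_mul, sub_mul, one_mul,
      map_sub, coeff_derivative]
    cases l with
    | zero => simp [hS, coeff_succ_oneSubSqrtSeries, coeff_zero_oneSubSqrtSeries, oneSubSqrtCoeff,
        -coeff_zero_eq_constantCoeff, coeff_zero_X_mul]
    | succ l =>
      rw [coeff_succ_X_mul, coeff_derivative, map_neg, hS, coeff_succ_oneSubSqrtSeries,
        coeff_succ_oneSubSqrtSeries, oneSubSqrtCoeff]
      push_cast
      field_simp
      ring
  set U := S ^ 2 with hU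
  -- hence `S ^ 2` satisfies the differential equation of `1 - x`, which determines it
  have hU' : (1 - X) * d⁄dX ℝ U = -U := by
    rw [hU, derivative_pow]
    push_cast
    linear_combination S * hode
  have hrec : ∀ k : ℕ, coeff (k + 2) U * (k + 2) = k * coeff (k + 1) U := by
    intro k
    have h := congrArg (coeff (k + 1)) hU'
    rw [sub_mul, one_mul, map_sub, coeff_succ_X_mul, coeff_derivative, coeff_derivative,
      map_neg] at h
    push_cast at h
    linarith
  have h0 : coeff 0 U = 1 := by
    have := coeff_zero_oneSubSqrtSeries
    rw [coeff_zero_eq_constantCoeff_apply] at this ⊢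
    rw [hU, map_pow, hS, this, one_pow]
  have h1 : coeff 1 U = -1 := by
    have h := congrArg (coeff 0) hU'
    rw [sub_mul, one_mul, map_sub, coeff_zero_X_mul, coeff_derivative, map_neg, h0] at h
    simpa using h
  have h2 : ∀ k : ℕ, coeff (k + 2) U = 0 := by
    intro k
    induction k with
    | zero => simpa using hrec 0
    | succ k ih =>
      have h := hrec (k + 1)
      rw [ih, mul_zero] at h
      exact (mul_eq_zero.mp h).resolve_right (by positivity)
  ext k
  match k with
  | 0 => rw [h0]; simp
  | 1 => rw [h1]; simp [coeff_one]
  | k + 2 => rw [h2]; simp [coeff_one, coeff_X]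

/-- `√(1 + z + z²) √(1 - z) = √(1 - z³)`. -/
theorem sqrtTrinomialSeries_mul_oneSubSqrtSeries :
    sqrtTrinomialSeries * oneSubSqrtSeries = expand 3 three_ne_zero oneSubSqrtSeries := by
  have hsq : (sqrtTrinomialSeries * oneSubSqrtSeries) ^ 2 =
      (expand 3 three_ne_zero oneSubSqrtSeries) ^ 2 := by
    rw [mul_pow, sqrtTrinomialSeries_sq, oneSubSqrtSeries_sq, ← map_pow, oneSubSqrtSeries_sq,
      map_sub, map_one, expand_X]
    ring
  rcases sq_eq_sq_iff_eq_or_eq_neg.mp hsq with h | h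
  · exact h
  · have := congrArg constantCoeff h
    have h0 := coeff_zero_oneSubSqrtSeries
    rw [coeff_zero_eq_constantCoeff_apply] at h0
    rw [map_mul, map_neg, h0, constantCoeff_expand, h0] at this
    norm_num [sqrtTrinomialSeries, sqrtTrinomialCoeff_zero] at this

/-- The constants `3 / 2` and `9 / 8` are chosen so that the inequality propagates from `j` to
`j + 1`. The analogue for `b_2`, `b_1` and `oneSubSqrtCoeff 0` is false, so the first block is
treated separately in `sqrtTrinomialCoeff_block_le`. -/
theorem sqrtTrinomialCoeff_le_oneSubSqrtCoeff_aux (j : ℕ) :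
    3 / 2 * sqrtTrinomialCoeff (3 * j + 5) + 9 / 8 * sqrtTrinomialCoeff (3 * j + 4) ≤
      oneSubSqrtCoeff (j + 1) := by
  induction j with
  | zero =>
    have h4 := sqrtTrinomialCoeff_three_mul_add_four 0
    have h5 := sqrtTrinomialCoeff_three_mul_add_five 0
    norm_num [sqrtTrinomialCoeff_one, sqrtTrinomialCoeff_two] at h4 h5
    norm_num [oneSubSqrtCoeff, h4, h5]
  | succ i ih =>
    obtain ⟨hu, hv, -⟩ := sqrtTrinomialCoeff_sign (i + 1)
    have h4 := sqrtTrinomialCoeff_three_mul_add_four (i + 1)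
    have h5 := sqrtTrinomialCoeff_three_mul_add_five (i + 1)
    rw [show 3 * i + 5 = 3 * (i + 1) + 2 by ring, show 3 * i + 4 = 3 * (i + 1) + 1 by ring] at ih
    rw [oneSubSqrtCoeff]
    refine le_trans ?_ (mul_le_mul_of_nonneg_right ih (by positivity))
    rw [h4, h5]
    set u := sqrtTrinomialCoeff (3 * (i + 1) + 1)
    set v := sqrtTrinomialCoeff (3 * (i + 1) + 2)
    have hx : (1 : ℝ) ≤ ((i + 1 : ℕ) : ℝ) := by exact_mod_cast Nat.succ_le_succ (Nat.zero_le i)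
    generalize ((i + 1 : ℕ) : ℝ) = x at *
    have hx0 : 0 ≤ x := by linarith
    have hv' : (3 / 2 * (216 * x ^ 3 + 540 * x ^ 2 + 390 * x + 75) + 27 / 8 * (6 * x + 10)) /
        ((6 * x + 6) * (6 * x + 8) * (6 * x + 10)) ≤ 3 / 2 * ((2 * x + 1) / (2 * x + 4)) := by
      rw [← mul_div_assoc, div_le_div_iff₀ (by positivity) (by positivity)]
      nlinarith [mul_nonneg hx0 hx0]
    have hu' : 9 / 8 * (6 * x * (6 * x + 5)) / ((6 * x + 6) * (6 * x + 8)) ≤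
        9 / 8 * ((2 * x + 1) / (2 * x + 4)) := by
      rw [← mul_div_assoc, div_le_div_iff₀ (by positivity) (by positivity)]
      nlinarith [mul_nonneg hx0 hx0]
    have hxu : 0 ≤ 3 / 2 * (18 * x * u) / ((6 * x + 6) * (6 * x + 8) * (6 * x + 10)) := by
      positivity
    calc _ = (3 / 2 * (216 * x ^ 3 + 540 * x ^ 2 + 390 * x + 75) + 27 / 8 * (6 * x + 10)) /
            ((6 * x + 6) * (6 * x + 8) * (6 * x + 10)) * v +
          9 / 8 * (6 * x * (6 * x + 5)) / ((6 * x + 6) * (6 * x + 8)) * u -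
          3 / 2 * (18 * x * u) / ((6 * x + 6) * (6 * x + 8) * (6 * x + 10)) := by
          field_simp
          ring
      _ ≤ 3 / 2 * ((2 * x + 1) / (2 * x + 4)) * v + 9 / 8 * ((2 * x + 1) / (2 * x + 4)) * u := by
          linarith [mul_le_mul_of_nonneg_right hv' hv.le, mul_le_mul_of_nonneg_right hu' hu]
      _ = _ := by ring

/-- The estimate behind the nonnegativity of `weightedPartialSum M (3 * (M / 3))` for
`M = 3 * J + 2`. -/
theorem sqrtTrinomialCoeff_block_le (J : ℕ) :
    -sqrtTrinomialCoeff (3 * J + 3) + sqrtTrinomialCoeff (3 * J + 2) / 2 +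
      sqrtTrinomialCoeff (3 * J + 1) / 8 ≤ oneSubSqrtCoeff J := by
  cases J with
  | zero =>
    have h3 := sqrtTrinomialCoeff_three_mul_add_three 0
    norm_num [sqrtTrinomialCoeff_one, sqrtTrinomialCoeff_two] at h3
    norm_num [oneSubSqrtCoeff, sqrtTrinomialCoeff_one, sqrtTrinomialCoeff_two, h3]
  | succ j =>
    refine le_trans ?_ (sqrtTrinomialCoeff_le_oneSubSqrtCoeff_aux j)
    obtain ⟨hu, hv, -⟩ := sqrtTrinomialCoeff_sign (j + 1)
    have h3 := sqrtTrinomialCoeff_three_mul_add_three (j + 1)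
    rw [show 3 * (j + 1) + 1 = 3 * j + 4 by ring, show 3 * (j + 1) + 2 = 3 * j + 5 by ring] at *
    have : -sqrtTrinomialCoeff (3 * (j + 1) + 3) ≤
        sqrtTrinomialCoeff (3 * j + 5) + sqrtTrinomialCoeff (3 * j + 4) := by
      rw [h3, neg_div, neg_neg, div_le_iff₀ (by positivity)]
      nlinarith
    linarith

/-! ### Weighted partial sums of the coefficients -/

/-- The sum `∑_{k ≤ n} b_k |s_{M + 1 - k}|`, where `s_i` are the coefficients of `√(1 - z)`.
For `n ≤ M` it is minus the coefficient of `z ^ (M + 1)` in `T_n(z) √(1 - z)`. -/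
noncomputable def weightedPartialSum (M n : ℕ) : ℝ :=
  ∑ k ∈ Finset.range (n + 1), sqrtTrinomialCoeff k * oneSubSqrtCoeff (M - k)

theorem weightedPartialSum_succ (M n : ℕ) : weightedPartialSum M (n + 1) =
    weightedPartialSum M n + sqrtTrinomialCoeff (n + 1) * oneSubSqrtCoeff (M - (n + 1)) :=
  Finset.sum_range_succ _ _

theorem weightedPartialSum_zero_nonneg (M : ℕ) : 0 ≤ weightedPartialSum M 0 := by
  simp [weightedPartialSum, sqrtTrinomialCoeff_zero, (oneSubSqrtCoeff_pos M).le]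

theorem coeff_succ_mk_mul_oneSubSqrtSeries (c : ℕ → ℝ) (M : ℕ) :
    coeff (M + 1) (PowerSeries.mk c * oneSubSqrtSeries) =
      c (M + 1) - ∑ k ∈ Finset.range (M + 1), c k * oneSubSqrtCoeff (M - k) := by
  rw [coeff_mul, Finset.Nat.sum_antidiagonal_eq_sum_range_succ_mk, Finset.sum_range_succ,
    Nat.sub_self, coeff_zero_oneSubSqrtSeries, add_comm, sub_eq_add_neg, ← Finset.sum_neg_distrib]
  congr 1
  · simp
  · refine Finset.sum_congr rfl fun k hk => ?_
    have hk' : k ≤ M := Nat.lt_succ_iff.mp (Finset.mem_range.mp hk)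
    rw [Nat.succ_sub hk', coeff_succ_oneSubSqrtSeries, coeff_mk, mul_neg]

theorem weightedPartialSum_self (M : ℕ) : weightedPartialSum M M =
    sqrtTrinomialCoeff (M + 1) - coeff (M + 1) (expand 3 three_ne_zero oneSubSqrtSeries) := by
  rw [← sqrtTrinomialSeries_mul_oneSubSqrtSeries, sqrtTrinomialSeries,
    coeff_succ_mk_mul_oneSubSqrtSeries, weightedPartialSum]
  ring

/-- For the largest multiple of three in question, the sum differs by at most two explicit terms
from `weightedPartialSum M M`, which `weightedPartialSum_self` evaluates. -/
theorem weightedPartialSum_last_block_nonneg (M : ℕ) :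
    0 ≤ weightedPartialSum M (3 * (M / 3)) := by
  obtain ⟨J, r, hr, rfl⟩ : ∃ J r, r < 3 ∧ M = 3 * J + r :=
    ⟨M / 3, M % 3, Nat.mod_lt _ (by norm_num), (Nat.div_add_mod M 3).symm⟩
  have hJ : (3 * J + r) / 3 = J := by omega
  rw [hJ]
  obtain ⟨hu, hv, huv⟩ := sqrtTrinomialCoeff_sign J
  have hself := weightedPartialSum_self (3 * J + r)
  interval_cases r
  · rw [coeff_expand_of_not_dvd _ _ _ (by omega), sub_zero] at hself
    exact hu.trans_eq hself.symm
  · rw [coeff_expand_of_not_dvd _ _ _ (by omega), weightedPartialSum_succ, Nat.sub_self,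
      oneSubSqrtCoeff] at hself
    rw [show 3 * J + 1 + 1 = 3 * J + 2 by ring] at hself
    linarith
  · rw [show 3 * J + 2 + 1 = 3 * (J + 1) by ring, coeff_expand_mul, coeff_succ_oneSubSqrtSeries,
      weightedPartialSum_succ, weightedPartialSum_succ, Nat.sub_self,
      show 3 * J + 2 - (3 * J + 1) = 1 by omega, show 3 * J + 1 + 1 = 3 * J + 2 by ring,
      show 3 * (J + 1) = 3 * J + 3 by ring] at hself
    norm_num [oneSubSqrtCoeff] at hself
    have := sqrtTrinomialCoeff_block_le J
    linarith

/-- The increment between consecutive multiples of three, after `b_{3j+3}` is expressed through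
`b_{3j+1}` and `b_{3j+2}` by the recurrence, so that only nonnegative coefficients are left. -/
theorem weightedPartialSum_block_succ (M j : ℕ) (h : 3 * j + 3 ≤ M) :
    weightedPartialSum M (3 * (j + 1)) = weightedPartialSum M (3 * j) +
      oneSubSqrtCoeff (M - (3 * j + 3)) *
      (sqrtTrinomialCoeff (3 * j + 1) *
        ((2 * (M - (3 * j + 3) : ℕ) + 1) * (2 * (M - (3 * j + 3) : ℕ) + 3) /
          ((2 * (M - (3 * j + 3) : ℕ) + 4) * (2 * (M - (3 * j + 3) : ℕ) + 6))
          - 2 * j / (2 * j + 2)) +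
      sqrtTrinomialCoeff (3 * j + 2) *
        ((2 * (M - (3 * j + 3) : ℕ) + 1) / (2 * (M - (3 * j + 3) : ℕ) + 4)
          - (2 * j + 1) / (2 * j + 2))) := by
  obtain ⟨l, rfl⟩ := Nat.exists_eq_add_of_le h
  rw [show 3 * (j + 1) = 3 * j + 1 + 1 + 1 by ring, weightedPartialSum_succ,
    weightedPartialSum_succ, weightedPartialSum_succ,
    show 3 * j + 3 + l - (3 * j + 1 + 1 + 1) = l by omega,
    show 3 * j + 3 + l - (3 * j + 1 + 1) = l + 1 by omega,
    show 3 * j + 3 + l - (3 * j + 1) = l + 2 by omega,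
    show 3 * j + 1 + 1 + 1 = 3 * j + 3 by ring, show 3 * j + 1 + 1 = 3 * j + 2 by ring,
    sqrtTrinomialCoeff_three_mul_add_three]
  simp only [oneSubSqrtCoeff]
  push_cast
  field_simp
  ring

/-- Under this condition both brackets in `weightedPartialSum_block_succ` are nonnegative. -/
theorem weightedPartialSum_block_mono (M j : ℕ) (h : 6 * j + 4 ≤ M) :
    weightedPartialSum M (3 * j) ≤ weightedPartialSum M (3 * (j + 1)) := by
  obtain ⟨hu, hv, -⟩ := sqrtTrinomialCoeff_sign j
  rw [weightedPartialSum_block_succ M j (by omega)]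
  have hl : (3 * j + 1 : ℝ) ≤ ((M - (3 * j + 3) : ℕ) : ℝ) := by
    exact_mod_cast (show 3 * j + 1 ≤ M - (3 * j + 3) by omega)
  have hw := oneSubSqrtCoeff_pos (M - (3 * j + 3))
  generalize ((M - (3 * j + 3) : ℕ) : ℝ) = l at *
  have hj : (0 : ℝ) ≤ j := j.cast_nonneg
  generalize (j : ℝ) = x at *
  have hl0 : 0 ≤ l := by linarith
  refine le_add_of_nonneg_right (mul_nonneg hw.le (add_nonneg (mul_nonneg hu ?_)
    (mul_nonneg hv.le ?_)))
  · rw [sub_nonneg, div_le_div_iff₀ (by positivity) (by positivity)]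
    nlinarith
  · rw [sub_nonneg, div_le_div_iff₀ (by positivity) (by positivity)]
    nlinarith

/-- Under this condition both brackets in `weightedPartialSum_block_succ` are nonpositive. Together
with `weightedPartialSum_block_mono` this leaves at most one `j`, that with `M = 6 * j + 3`, for
which the sign of the increment is undetermined. -/
theorem weightedPartialSum_block_anti (M j : ℕ) (h : 3 * j + 3 ≤ M) (h' : M ≤ 6 * j + 2) :
    weightedPartialSum M (3 * (j + 1)) ≤ weightedPartialSum M (3 * j) := by
  obtain ⟨hu, hv, -⟩ := sqrtTrinomialCoeff_sign j
  rw [weightedPartialSum_block_succ M j (by omega)]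
  have hl : ((M - (3 * j + 3) : ℕ) : ℝ) + 1 ≤ 3 * j := by
    exact_mod_cast (show (M - (3 * j + 3)) + 1 ≤ 3 * j by omega)
  have hw := oneSubSqrtCoeff_pos (M - (3 * j + 3))
  have hl0 : (0 : ℝ) ≤ ((M - (3 * j + 3) : ℕ) : ℝ) := Nat.cast_nonneg _
  generalize ((M - (3 * j + 3) : ℕ) : ℝ) = l at *
  have hj : (0 : ℝ) ≤ j := j.cast_nonneg
  generalize (j : ℝ) = x at *
  refine add_le_of_nonpos_right (mul_nonpos_of_nonneg_of_nonpos hw.le (add_nonpos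
    (mul_nonpos_of_nonneg_of_nonpos hu ?_) (mul_nonpos_of_nonneg_of_nonpos hv.le ?_)))
  · rw [sub_nonpos, div_le_div_iff₀ (by positivity) (by positivity)]
    nlinarith
  · rw [sub_nonpos, div_le_div_iff₀ (by positivity) (by positivity)]
    nlinarith

/-- As `j` grows, the sums `weightedPartialSum M (3 * j)` first increase and then decrease, so that
they are bounded below by the first or by the last of them. -/
theorem weightedPartialSum_block_nonneg (M j : ℕ) (h : 3 * j ≤ M) :
    0 ≤ weightedPartialSum M (3 * j) := by
  rcases le_total (6 * j) (M + 2) with hj | hj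
  · clear h
    induction j with
    | zero => exact weightedPartialSum_zero_nonneg M
    | succ j ih => exact (ih (by omega)).trans (weightedPartialSum_block_mono M j (by omega))
  · have hle : j ≤ M / 3 := by omega
    have : ∀ i, j ≤ i → i ≤ M / 3 →
        weightedPartialSum M (3 * i) ≤ weightedPartialSum M (3 * j) := by
      intro i hi
      induction i, hi using Nat.le_induction with
      | base => intro _; exact le_rfl
      | succ i hi ih =>
        intro hi'
        exact (weightedPartialSum_block_anti M i (by omega) (by omega)).trans (ih (by omega))
    exact (weightedPartialSum_last_block_nonneg M).trans (this _ hle le_rfl)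

theorem weightedPartialSum_nonneg {M n : ℕ} (h : n ≤ M) : 0 ≤ weightedPartialSum M n := by
  obtain ⟨j, r, hr, rfl⟩ : ∃ j r, r < 3 ∧ n = 3 * j + r :=
    ⟨n / 3, n % 3, Nat.mod_lt _ (by norm_num), (Nat.div_add_mod n 3).symm⟩
  have h0 := weightedPartialSum_block_nonneg M j (by omega)
  obtain ⟨hu, hv, -⟩ := sqrtTrinomialCoeff_sign j
  have hu' := mul_nonneg hu (oneSubSqrtCoeff_pos (M - (3 * j + 1))).le
  have hv' := mul_nonneg hv.le (oneSubSqrtCoeff_pos (M - (3 * j + 2))).le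
  interval_cases r
  · exact h0
  · rw [weightedPartialSum_succ]
    linarith
  · rw [weightedPartialSum_succ, weightedPartialSum_succ]
    rw [show 3 * j + 1 + 1 = 3 * j + 2 by ring]
    linarith

/-! ### The partial sums have no zeros in the disk -/

/-- The partial sum `T_n` as a formal power series. -/
noncomputable def sqrtTrinomialTrunc (n : ℕ) : PowerSeries ℝ :=
  PowerSeries.mk fun k => if k ≤ n then sqrtTrinomialCoeff k else 0

theorem coeff_sqrtTrinomialTrunc_of_le {n k : ℕ} (h : k ≤ n) :
    coeff k (sqrtTrinomialTrunc n) = sqrtTrinomialCoeff k := by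
  simp [sqrtTrinomialTrunc, h]

theorem coeff_sqrtTrinomialTrunc_of_lt {n k : ℕ} (h : n < k) :
    coeff k (sqrtTrinomialTrunc n) = 0 := by
  simp [sqrtTrinomialTrunc, h.not_ge]

theorem coeff_zero_trunc_mul (n : ℕ) :
    coeff 0 (sqrtTrinomialTrunc n * oneSubSqrtSeries) = 1 := by
  rw [coeff_mul, Finset.Nat.antidiagonal_zero, Finset.sum_singleton,
    coeff_sqrtTrinomialTrunc_of_le n.zero_le, sqrtTrinomialCoeff_zero,
    coeff_zero_oneSubSqrtSeries, one_mul]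

theorem coeff_succ_trunc_mul_nonpos (n m : ℕ) :
    coeff (m + 1) (sqrtTrinomialTrunc n * oneSubSqrtSeries) ≤ 0 := by
  rw [sqrtTrinomialTrunc, coeff_succ_mk_mul_oneSubSqrtSeries]
  rcases lt_or_ge m n with h | h
  · have h1 : ∑ k ∈ Finset.range (m + 1),
        (if k ≤ n then sqrtTrinomialCoeff k else 0) * oneSubSqrtCoeff (m - k) =
        weightedPartialSum m m := by
      refine Finset.sum_congr rfl fun k hk => ?_
      rw [if_pos (by have := Finset.mem_range.mp hk; omega)]
    rw [h1, if_pos (by omega), weightedPartialSum_self, sub_sub_cancel, coeff_expand]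
    split_ifs with hd
    · obtain ⟨q, hq⟩ := Nat.exists_eq_add_of_lt (Nat.div_pos (Nat.le_of_dvd m.succ_pos hd)
        (by norm_num : 0 < 3))
      rw [hq, Nat.zero_add, coeff_succ_oneSubSqrtSeries]
      exact neg_nonpos.mpr (oneSubSqrtCoeff_pos q).le
    · exact le_rfl
  · have h1 : ∑ k ∈ Finset.range (m + 1),
        (if k ≤ n then sqrtTrinomialCoeff k else 0) * oneSubSqrtCoeff (m - k) =
        weightedPartialSum m n := by
      rw [weightedPartialSum]
      symm
      refine Finset.sum_subset_zero_on_sdiff (Finset.range_mono (by omega)) ?_ ?_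
      · intro k hk
        have : ¬ k ≤ n := by
          have := (Finset.mem_sdiff.mp hk).2
          simp at this
          omega
        rw [if_neg this, zero_mul]
      · intro k hk
        rw [if_pos (by have := Finset.mem_range.mp hk; omega)]
    rw [h1, if_neg (by omega), zero_sub, neg_nonpos]
    exact weightedPartialSum_nonneg h

theorem summable_coeff_oneSubSqrtSeries : Summable fun k => |coeff k oneSubSqrtSeries| := by
  refine (summable_nat_add_iff 1).mp ?_
  refine summable_oneSubSqrtCoeff.congr fun l => ?_
  rw [coeff_succ_oneSubSqrtSeries, abs_neg, abs_of_pos (oneSubSqrtCoeff_pos l)]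

theorem hasSum_coeff_oneSubSqrtSeries : HasSum (fun k => coeff k oneSubSqrtSeries) 0 := by
  -- the square of the sum is the value at `1` of the squared series `1 - x`
  obtain ⟨σ, hσ⟩ := summable_coeff_oneSubSqrtSeries.of_abs
  have hσ1 : HasSum (fun k => coeff k oneSubSqrtSeries * 1 ^ k) σ := by simpa using hσ
  have h := hasSum_coeff_mul hσ1 hσ1
  rw [← pow_two, ← pow_two, oneSubSqrtSeries_sq] at h
  have h2 : HasSum (fun k => coeff k (1 - X : PowerSeries ℝ) * 1 ^ k) 0 := by
    have := hasSum_sum_of_ne_finset_zero (L := .unconditional ℕ) (s := Finset.range 2)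
      (f := fun k => coeff k (1 - X : PowerSeries ℝ) * 1 ^ k) (fun k hk => by
        have : 1 < k := by simpa using hk
        simp [coeff_one, coeff_X, show k ≠ 0 by omega, show k ≠ 1 by omega])
    convert! this using 1
    norm_num [Finset.sum_range_succ, coeff_one, coeff_X]
  have h3 : σ ^ 2 = 0 := h.unique h2
  rwa [pow_eq_zero_iff two_ne_zero |>.mp h3] at hσ

/-- The coefficients of `T_n(z) √(1 - z)` of positive index are nonpositive and add up to `-1`. -/
theorem hasSum_neg_coeff_succ_trunc_mul (n : ℕ) :
    HasSum (fun m => -coeff (m + 1) (sqrtTrinomialTrunc n * oneSubSqrtSeries)) 1 := by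
  have hT := hasSum_sum_of_ne_finset_zero (L := .unconditional ℕ) (s := Finset.range (n + 1))
    (f := fun k => coeff k (sqrtTrinomialTrunc n) * 1 ^ k) (fun k hk => by
      rw [coeff_sqrtTrinomialTrunc_of_lt (by simpa [Nat.lt_succ_iff] using hk), zero_mul])
  have hS : HasSum (fun k => coeff k oneSubSqrtSeries * 1 ^ k) 0 := by
    simpa using hasSum_coeff_oneSubSqrtSeries
  have h := hasSum_coeff_mul hT hS
  rw [mul_zero] at h
  have h2 := (hasSum_nat_add_iff' 1).mpr h
  simpa [coeff_zero_trunc_mul, -coeff_zero_eq_constantCoeff] using h2.neg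

/-- The series `sqrtTrinomialTrunc n` sums to the polynomial `T_n`. -/
theorem hasSum_coeff_trunc (n : ℕ) (z : ℂ) :
    HasSum (fun k => coeff k ((sqrtTrinomialTrunc n).map Complex.ofRealHom) * z ^ k)
      (sqrtTrinomialPoly n z) := by
  have h := hasSum_sum_of_ne_finset_zero (L := .unconditional ℕ) (s := Finset.range (n + 1))
    (f := fun k => coeff k ((sqrtTrinomialTrunc n).map Complex.ofRealHom) * z ^ k) (fun k hk => by
      rw [coeff_map, coeff_sqrtTrinomialTrunc_of_lt (by simpa [Nat.lt_succ_iff] using hk), map_zero,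
        zero_mul])
  convert! h using 1
  refine Finset.sum_congr rfl fun k hk => ?_
  rw [coeff_map, coeff_sqrtTrinomialTrunc_of_le (Nat.lt_succ_iff.mp (Finset.mem_range.mp hk))]
  rfl

theorem sqrtTrinomialPoly_ne_zero (n : ℕ) {z : ℂ} (hz : z ∈ ball (0 : ℂ) 1) :
    sqrtTrinomialPoly n z ≠ 0 := by
  intro h0
  rw [mem_ball_zero_iff] at hz
  set E := sqrtTrinomialTrunc n * oneSubSqrtSeries with hE
  have hS : Summable fun k => coeff k (oneSubSqrtSeries.map Complex.ofRealHom) * z ^ k := by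
    refine Summable.of_norm_bounded summable_coeff_oneSubSqrtSeries fun k => ?_
    rw [norm_mul, norm_pow, coeff_map, Complex.ofRealHom_eq_coe, Complex.norm_real,
      Real.norm_eq_abs]
    exact mul_le_of_le_one_right (abs_nonneg _) (pow_le_one₀ (norm_nonneg _) hz.le)
  have h := hasSum_coeff_mul (hasSum_coeff_trunc n z) hS.hasSum
  rw [h0, zero_mul, ← map_mul, ← hE] at h
  have h2 := (hasSum_nat_add_iff' 1).mpr h
  simp only [Finset.range_one, Finset.sum_singleton, coeff_map, hE, coeff_zero_trunc_mul, map_one,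
    pow_zero, mul_one, zero_sub] at h2
  -- a zero at `z` would write `-1` as a sum of terms of total norm at most `‖z‖`
  have h3 : ‖(-1 : ℂ)‖ ≤ ‖z‖ * 1 := by
    refine h2.norm_le_of_bounded ((hasSum_neg_coeff_succ_trunc_mul n).mul_left ‖z‖) fun m => ?_
    rw [norm_mul, norm_pow, Complex.ofRealHom_eq_coe, Complex.norm_real, Real.norm_eq_abs,
      abs_of_nonpos (coeff_succ_trunc_mul_nonpos n m), mul_comm, pow_succ]
    refine mul_le_mul_of_nonneg_right ?_ (neg_nonneg.mpr (coeff_succ_trunc_mul_nonpos n m))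
    exact mul_le_of_le_one_left (norm_nonneg _) (pow_le_one₀ (norm_nonneg _) hz.le)
  norm_num at h3
  linarith

/-! ### Finite Blaschke products -/

theorem norm_blaschkeFactor_le_one {α z : ℂ} (hα : ‖α‖ < 1) (hz : ‖z‖ < 1) :
    ‖(z - α) / (1 - (starRingEnd ℂ) α * z)‖ ≤ 1 := by
  rw [norm_div]
  refine div_le_one_of_le₀ ?_ (norm_nonneg _)
  rw [← sq_le_sq₀ (norm_nonneg _) (norm_nonneg _), Complex.sq_norm, Complex.sq_norm]
  have h1 : Complex.normSq α ≤ 1 := by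
    rw [← Complex.sq_norm]; exact pow_le_one₀ (norm_nonneg _) hα.le
  have h2 : Complex.normSq z ≤ 1 := by
    rw [← Complex.sq_norm]; exact pow_le_one₀ (norm_nonneg _) hz.le
  rw [Complex.normSq_apply] at h1 h2 ⊢
  rw [Complex.normSq_apply]
  simp only [Complex.sub_re, Complex.sub_im, Complex.one_re, Complex.one_im, Complex.mul_re,
    Complex.mul_im, Complex.conj_re, Complex.conj_im]
  nlinarith [mul_nonneg (sub_nonneg.mpr h1) (sub_nonneg.mpr h2)]

theorem IsFiniteBlaschkeProduct.norm_le_one {f : ℂ → ℂ} (hf : IsFiniteBlaschkeProduct f) {z : ℂ}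
    (hz : z ∈ ball (0 : ℂ) 1) : ‖f z‖ ≤ 1 := by
  obtain ⟨d, c, α, hc, hα, h⟩ := hf
  rw [h z hz, norm_mul, hc, one_mul, norm_prod]
  exact Finset.prod_le_one (fun _ _ => norm_nonneg _) fun i _ =>
    norm_blaschkeFactor_le_one (mem_ball_zero_iff.mp (hα i)) (mem_ball_zero_iff.mp hz)

/-- A product of Blaschke factors whose zeros lie in the closed disk is a finite Blaschke product:
the factors with `‖α‖ = 1` are unimodular constants. -/
theorem isFiniteBlaschkeProduct_multiset_prod (s : Multiset ℂ) (hs : ∀ α ∈ s, ‖α‖ ≤ 1) :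
    IsFiniteBlaschkeProduct
      fun z => (s.map fun α => (z - α) / (1 - (starRingEnd ℂ) α * z)).prod := by
  induction s using Multiset.induction_on with
  | empty => exact ⟨0, 1, Fin.elim0, norm_one, fun i => i.elim0, fun z _ => by simp⟩
  | cons β s ih =>
    obtain ⟨d, c, α, hc, hα, h⟩ := ih fun γ hγ => hs γ (Multiset.mem_cons_of_mem hγ)
    rcases (hs β (Multiset.mem_cons_self β s)).lt_or_eq with hβ | hβ
    · refine ⟨d + 1, c, Fin.cons β α, hc, Fin.cases (mem_ball_zero_iff.mpr hβ) hα, fun z hz => ?_⟩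
      simp only [Multiset.map_cons, Multiset.prod_cons, h z hz, Fin.prod_univ_succ, Fin.cons_zero,
        Fin.cons_succ]
      ring
    · refine ⟨d, -β * c, α, by rw [norm_mul, norm_neg, hβ, hc, one_mul], hα, fun z hz => ?_⟩
      have hββ : (starRingEnd ℂ) β * β = 1 := by
        rw [Complex.conj_mul', hβ]; norm_num
      have hne : 1 - (starRingEnd ℂ) β * z ≠ 0 := by
        intro h0
        have h1 : ‖(starRingEnd ℂ) β * z‖ = 1 := by
          rw [← sub_eq_zero.mp h0, norm_one]
        rw [norm_mul, RCLike.norm_conj, hβ, one_mul] at h1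
        exact (mem_ball_zero_iff.mp hz).ne h1
      have hfac : (z - β) / (1 - (starRingEnd ℂ) β * z) = -β := by
        rw [div_eq_iff hne]
        linear_combination (-z) * hββ
      simp only [Multiset.map_cons, Multiset.prod_cons, h z hz, hfac]
      ring

/-- The polynomial `z ^ n T_n(1 / z)`. -/
noncomputable def reversedPoly (n : ℕ) : Polynomial ℂ :=
  ∑ k ∈ Finset.range (n + 1), Polynomial.monomial (n - k) (sqrtTrinomialCoeff k : ℂ)

theorem eval_reversedPoly (n : ℕ) (z : ℂ) : (reversedPoly n).eval z =
    ∑ k ∈ Finset.range (n + 1), (sqrtTrinomialCoeff k : ℂ) * z ^ (n - k) := by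
  simp [reversedPoly, Polynomial.eval_finsetSum]

theorem natDegree_reversedPoly_le (n : ℕ) : (reversedPoly n).natDegree ≤ n :=
  Polynomial.natDegree_sum_le_of_forall_le _ _ fun k _ =>
    (Polynomial.natDegree_monomial_le _).trans (Nat.sub_le n k)

theorem coeff_reversedPoly_self (n : ℕ) : (reversedPoly n).coeff n = 1 := by
  rw [reversedPoly, Polynomial.finsetSum_coeff, Finset.sum_eq_single 0]
  · simp [sqrtTrinomialCoeff_zero]
  · intro k hk hk0
    have := Finset.mem_range.mp hk
    rw [Polynomial.coeff_monomial, if_neg (by omega)]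
  · simp

theorem monic_reversedPoly (n : ℕ) : (reversedPoly n).Monic :=
  Polynomial.monic_of_natDegree_le_of_coeff_eq_one n (natDegree_reversedPoly_le n)
    (coeff_reversedPoly_self n)

theorem natDegree_reversedPoly (n : ℕ) : (reversedPoly n).natDegree = n :=
  (natDegree_reversedPoly_le n).antisymm
    (Polynomial.le_natDegree_of_ne_zero (by simp [coeff_reversedPoly_self]))

theorem eval_reversedPoly_eq_prod (n : ℕ) (z : ℂ) :
    (reversedPoly n).eval z = ((reversedPoly n).roots.map fun α => z - α).prod := by
  conv_lhs => rw [(IsAlgClosed.splits (reversedPoly n)).eq_prod_roots_of_monic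
    (monic_reversedPoly n)]
  rw [Polynomial.eval_multiset_prod, Multiset.map_map]
  simp

theorem card_roots_reversedPoly (n : ℕ) : (reversedPoly n).roots.card = n := by
  rw [← (IsAlgClosed.splits (reversedPoly n)).natDegree_eq_card_roots, natDegree_reversedPoly]

theorem sqrtTrinomialPoly_zero (n : ℕ) : sqrtTrinomialPoly n 0 = 1 := by
  simp [sqrtTrinomialPoly, Finset.sum_range_succ', sqrtTrinomialCoeff_zero]

theorem pow_mul_eval_reversedPoly (n : ℕ) {z : ℂ} (hz : z ≠ 0) :
    z ^ n * (reversedPoly n).eval z⁻¹ = sqrtTrinomialPoly n z := by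
  rw [eval_reversedPoly, sqrtTrinomialPoly, Finset.mul_sum]
  refine Finset.sum_congr rfl fun k hk => ?_
  have hkn : k ≤ n := Nat.lt_succ_iff.mp (Finset.mem_range.mp hk)
  obtain ⟨l, rfl⟩ := Nat.exists_eq_add_of_le hkn
  rw [Nat.add_sub_cancel_left, pow_add, inv_pow]
  field_simp

theorem sqrtTrinomialPoly_eq_prod (n : ℕ) (z : ℂ) :
    sqrtTrinomialPoly n z = ((reversedPoly n).roots.map fun α => 1 - α * z).prod := by
  rcases eq_or_ne z 0 with rfl | hz
  · simp [sqrtTrinomialPoly_zero]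
  · have hpow : z ^ n = ((reversedPoly n).roots.map fun _ => z).prod := by
      rw [Multiset.map_const', Multiset.prod_replicate, card_roots_reversedPoly]
    rw [← pow_mul_eval_reversedPoly n hz, eval_reversedPoly_eq_prod, hpow,
      ← Multiset.prod_map_mul]
    refine congrArg Multiset.prod (Multiset.map_congr rfl fun α _ => ?_)
    rw [mul_sub, mul_inv_cancel₀ hz, mul_comm]

theorem conj_sqrtTrinomialPoly (n : ℕ) (z : ℂ) :
    (starRingEnd ℂ) (sqrtTrinomialPoly n z) = sqrtTrinomialPoly n ((starRingEnd ℂ) z) := by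
  simp [sqrtTrinomialPoly]

/-- The coefficients are real, so the roots `α` may be replaced by their conjugates. -/
theorem sqrtTrinomialPoly_eq_prod_conj (n : ℕ) (z : ℂ) : sqrtTrinomialPoly n z =
    ((reversedPoly n).roots.map fun α => 1 - (starRingEnd ℂ) α * z).prod := by
  rw [← Complex.conj_conj z, ← conj_sqrtTrinomialPoly, sqrtTrinomialPoly_eq_prod,
    map_multiset_prod, Multiset.map_map]
  simp

theorem norm_le_one_of_mem_roots_reversedPoly {n : ℕ} {α : ℂ} (hα : α ∈ (reversedPoly n).roots) :
    ‖α‖ ≤ 1 := by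
  by_contra! h
  have hα0 : α ≠ 0 := by rintro rfl; norm_num at h
  have hb : α⁻¹ ∈ ball (0 : ℂ) 1 := by
    rw [mem_ball_zero_iff, norm_inv]
    exact inv_lt_one_of_one_lt₀ h
  apply sqrtTrinomialPoly_ne_zero n hb
  rw [← pow_mul_eval_reversedPoly n (inv_ne_zero hα0), inv_inv,
    (Polynomial.isRoot_of_mem_roots hα).eq_zero, mul_zero]

theorem isFiniteBlaschkeProduct_extremalQuotient (n : ℕ) :
    IsFiniteBlaschkeProduct (extremalQuotient n) := by
  have h := isFiniteBlaschkeProduct_multiset_prod (reversedPoly n).roots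
    fun α hα => norm_le_one_of_mem_roots_reversedPoly hα
  convert! h using 1
  funext z
  rw [extremalQuotient, ← eval_reversedPoly, eval_reversedPoly_eq_prod,
    sqrtTrinomialPoly_eq_prod_conj, Multiset.prod_map_div]

/-! ### Coefficients as integrals over the unit circle -/

theorem integral_exp_int_mul_I (m : ℤ) :
    ∫ t in (0 : ℝ)..2 * Real.pi, Complex.exp (m * (t * Complex.I)) =
      if m = 0 then 2 * Real.pi else 0 := by
  split_ifs with h
  · simp [h]
  · have hc : (m : ℂ) * Complex.I ≠ 0 := mul_ne_zero (by exact_mod_cast h) Complex.I_ne_zero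
    have h2 := integral_exp_mul_complex (a := 0) (b := 2 * Real.pi) hc
    have h3 : ∀ t : ℝ, (m : ℂ) * (t * Complex.I) = m * Complex.I * t := fun t => by ring
    simp_rw [h3]
    rw [h2]
    have h4 : (m : ℂ) * Complex.I * ((2 * Real.pi : ℝ) : ℂ) = m * (2 * Real.pi * Complex.I) := by
      push_cast; ring
    rw [h4, Complex.exp_int_mul_two_pi_mul_I]
    simp

/-- The `n`-th coefficient of a power series converging on the unit circle, as a Fourier
coefficient of its sum. -/
theorem integral_mul_exp_neg_eq_coeff {a : ℕ → ℂ} {F : ℂ → ℂ}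
    (h : ∀ z : ℂ, ‖z‖ = 1 → HasSum (fun k => a k * z ^ k) (F z)) (n : ℕ) :
    ∫ t in (0 : ℝ)..2 * Real.pi, F (Complex.exp (t * Complex.I)) *
      Complex.exp (-n * (t * Complex.I)) = 2 * Real.pi * a n := by
  have hs : Summable fun k => ‖a k‖ := by
    simpa using (h 1 norm_one).summable.norm
  have he : ∀ t : ℝ, ‖Complex.exp (t * Complex.I)‖ = 1 := Complex.norm_exp_ofReal_mul_I
  have hexp : ∀ (k : ℕ) (t : ℝ), a k * Complex.exp (t * Complex.I) ^ k *
      Complex.exp (-n * (t * Complex.I)) =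
      a k * Complex.exp (((k - n : ℤ) : ℂ) * (t * Complex.I)) := by
    intro k t
    rw [← Complex.exp_nat_mul, mul_assoc, ← Complex.exp_add]
    congr 2
    push_cast
    ring
  have hsum := intervalIntegral.hasSum_integral_of_dominated_convergence (μ := volume)
    (a := 0) (b := 2 * Real.pi)
    (F := fun (k : ℕ) (t : ℝ) => a k * Complex.exp (t * Complex.I) ^ k *
      Complex.exp (-n * (t * Complex.I)))
    (f := fun t : ℝ => F (Complex.exp (t * Complex.I)) * Complex.exp (-n * (t * Complex.I)))
    (fun k _ => ‖a k‖)
    (fun k => (Continuous.aestronglyMeasurable (by fun_prop)))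
    (fun k => ae_of_all _ fun t _ => by
      have h1 : ‖Complex.exp (-n * (t * Complex.I))‖ = 1 := by
        have := Complex.norm_exp_ofReal_mul_I (-n * t)
        push_cast at this
        rw [← this]; congr 2; ring
      rw [norm_mul, norm_mul, norm_pow, he, one_pow, mul_one, h1, mul_one])
    (ae_of_all _ fun t _ => hs)
    (by simp)
    (ae_of_all _ fun t _ => (h _ (he t)).mul_right _)
  refine hsum.unique ?_
  have hterm : (fun k : ℕ => ∫ t in (0 : ℝ)..2 * Real.pi, a k * Complex.exp (t * Complex.I) ^ k *
      Complex.exp (-n * (t * Complex.I))) = fun k => if k = n then 2 * Real.pi * a n else 0 := by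
    funext k
    simp_rw [hexp]
    rw [intervalIntegral.integral_const_mul, integral_exp_int_mul_I]
    by_cases hk : k = n
    · simp [hk, mul_comm]
    · rw [if_neg (by omega), if_neg hk, Complex.ofReal_zero, mul_zero]
  rw [hterm]
  exact hasSum_ite_eq n _

/-! ### The square of the partial sum -/

theorem coeff_mul_congr_right {R : Type*} [CommSemiring R] (A : PowerSeries R) {P Q : PowerSeries R}
    {n : ℕ} (h : ∀ j ≤ n, coeff j P = coeff j Q) : coeff n (A * P) = coeff n (A * Q) := by
  rw [coeff_mul, coeff_mul]
  refine Finset.sum_congr rfl fun p hp => ?_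
  rw [h _ (Finset.HasAntidiagonal.antidiagonal.snd_le hp)]

theorem coeff_sqrtTrinomialTrunc_sq {n j : ℕ} (h : j ≤ n) :
    coeff j (sqrtTrinomialTrunc n ^ 2) = coeff j (1 + X + X ^ 2 : PowerSeries ℝ) := by
  have key : ∀ i ≤ n, coeff i (sqrtTrinomialTrunc n) = coeff i sqrtTrinomialSeries := fun i hi => by
    rw [coeff_sqrtTrinomialTrunc_of_le hi, sqrtTrinomialSeries, coeff_mk]
  rw [← sqrtTrinomialSeries_sq, pow_two, pow_two,
    coeff_mul_congr_right _ fun i hi => key i (hi.trans h), mul_comm,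
    coeff_mul_congr_right _ fun i hi => key i (hi.trans h)]

/-- Multiplication by `T_n²` agrees with multiplication by `1 + z + z²` up to order `n`, hence
turns the coefficient of `z ^ n` into the sum of the last three coefficients. -/
theorem coeff_mk_mul_trunc_sq (a : ℕ → ℂ) {n : ℕ} (hn : 2 ≤ n) :
    coeff n (PowerSeries.mk a * (sqrtTrinomialTrunc n).map Complex.ofRealHom ^ 2) =
      seriesSegment a (n - 2) n 1 := by
  have h : ∀ j ≤ n, coeff j ((sqrtTrinomialTrunc n).map Complex.ofRealHom ^ 2) =
      coeff j (1 + X + X ^ 2 : PowerSeries ℂ) := by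
    intro j hj
    rw [← map_pow, coeff_map, coeff_sqrtTrinomialTrunc_sq hj, ← coeff_map]
    simp
  rw [coeff_mul_congr_right _ h]
  obtain ⟨m, rfl⟩ := Nat.exists_eq_add_of_le' hn
  have hX2 : coeff (m + 2) (PowerSeries.mk a * X ^ 2) = a m := by
    rw [coeff_mul_X_pow, coeff_mk]
  rw [mul_add, mul_add, mul_one, map_add, map_add, hX2, coeff_succ_mul_X, coeff_mk, coeff_mk,
    seriesSegment, Nat.add_sub_cancel, Finset.sum_Icc_succ_top (by omega),
    Finset.sum_Icc_succ_top (by omega), Finset.Icc_self, Finset.sum_singleton]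
  simp only [one_pow, mul_one]
  ring

theorem hasSum_coeff_polynomial (P : Polynomial ℂ) (z : ℂ) :
    HasSum (fun k => coeff k (P : PowerSeries ℂ) * z ^ k) (P.eval z) := by
  rw [Polynomial.eval_eq_sum_range]
  have h := hasSum_sum_of_ne_finset_zero (L := .unconditional ℕ)
    (s := Finset.range (P.natDegree + 1)) (f := fun k => P.coeff k * z ^ k) fun k hk => by
      rw [Polynomial.coeff_eq_zero_of_natDegree_lt (by simpa using hk), zero_mul]
  simpa only [Polynomial.coeff_coe] using h

theorem coeff_reversedPoly {n k : ℕ} (hk : k ≤ n) :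
    (reversedPoly n).coeff (n - k) = sqrtTrinomialCoeff k := by
  rw [reversedPoly, Polynomial.finsetSum_coeff, Finset.sum_eq_single k]
  · simp
  · intro i hi hik
    have := Finset.mem_range.mp hi
    rw [Polynomial.coeff_monomial, if_neg (by omega)]
  · intro h
    exact absurd (Finset.mem_range.mpr (by omega)) h

theorem coeff_trunc_mul_reversedPoly (n : ℕ) :
    coeff n ((sqrtTrinomialTrunc n).map Complex.ofRealHom * (reversedPoly n : PowerSeries ℂ)) =
      ((∑ k ∈ Finset.range (n + 1), sqrtTrinomialCoeff k ^ 2 : ℝ) : ℂ) := by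
  rw [coeff_mul, Finset.Nat.sum_antidiagonal_eq_sum_range_succ_mk, Complex.ofReal_sum]
  refine Finset.sum_congr rfl fun k hk => ?_
  have hkn : k ≤ n := Nat.lt_succ_iff.mp (Finset.mem_range.mp hk)
  rw [coeff_map, coeff_sqrtTrinomialTrunc_of_le hkn, Polynomial.coeff_coe, coeff_reversedPoly hkn,
    Complex.ofRealHom_eq_coe, pow_two, Complex.ofReal_mul]

theorem continuous_sqrtTrinomialPoly (n : ℕ) : Continuous (sqrtTrinomialPoly n) := by
  unfold sqrtTrinomialPoly
  fun_prop

/-- Parseval's identity for the polynomial `T_n`. -/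
theorem integral_norm_sqrtTrinomialPoly_sq (n : ℕ) :
    ∫ t in (0 : ℝ)..2 * Real.pi, ‖sqrtTrinomialPoly n (Complex.exp (t * Complex.I))‖ ^ 2 =
      2 * Real.pi * ∑ k ∈ Finset.range (n + 1), sqrtTrinomialCoeff k ^ 2 := by
  have h := integral_mul_exp_neg_eq_coeff (fun z _ =>
    hasSum_coeff_mul (hasSum_coeff_trunc n z) (hasSum_coeff_polynomial (reversedPoly n) z)) n
  rw [coeff_trunc_mul_reversedPoly] at h
  -- on the unit circle `z ^ n T_n(1 / z) z ^ (-n)` is the conjugate of `T_n(z)`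
  have hpt : ∀ t : ℝ, sqrtTrinomialPoly n (Complex.exp (t * Complex.I)) *
      (reversedPoly n).eval (Complex.exp (t * Complex.I)) * Complex.exp (-n * (t * Complex.I)) =
      ((‖sqrtTrinomialPoly n (Complex.exp (t * Complex.I))‖ ^ 2 : ℝ) : ℂ) := by
    intro t
    have hconj : (starRingEnd ℂ) (Complex.exp (t * Complex.I)) =
        (Complex.exp (t * Complex.I))⁻¹ := by
      rw [← Complex.exp_conj, ← Complex.exp_neg]
      simp
    have h1 : Complex.exp (-n * (t * Complex.I)) = ((Complex.exp (t * Complex.I))⁻¹) ^ n := by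
      rw [← Complex.exp_neg, ← Complex.exp_nat_mul]
      congr 1; ring
    have h2 := pow_mul_eval_reversedPoly n (inv_ne_zero (Complex.exp_ne_zero (t * Complex.I)))
    rw [inv_inv, ← hconj, ← conj_sqrtTrinomialPoly, hconj] at h2
    rw [h1, mul_assoc, mul_comm (Polynomial.eval _ _), h2, Complex.mul_conj']
    push_cast
    rfl
  simp_rw [hpt] at h
  rw [intervalIntegral.integral_ofReal] at h
  exact_mod_cast h

/-! ### The bound for segments -/

/-- The segment at `1` is the `n`-th Fourier coefficient of `F T_n²`, hence at most the mean of
`|T_n|²`. -/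
theorem norm_seriesSegment_one_le {a : ℕ → ℂ} {F : ℂ → ℂ}
    (h : ∀ z : ℂ, ‖z‖ = 1 → HasSum (fun k => a k * z ^ k) (F z)) (hF : ∀ z : ℂ, ‖z‖ = 1 → ‖F z‖ ≤ 1)
    {n : ℕ} (hn : 2 ≤ n) :
    ‖seriesSegment a (n - 2) n 1‖ ≤ ∑ k ∈ Finset.range (n + 1), sqrtTrinomialCoeff k ^ 2 := by
  have ha : ∀ z : ℂ, ‖z‖ = 1 → HasSum (fun k => coeff k (PowerSeries.mk a) * z ^ k) (F z) := by
    simpa using h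
  have h1 := integral_mul_exp_neg_eq_coeff (fun z hz => hasSum_coeff_mul (ha z hz)
    (hasSum_coeff_mul (hasSum_coeff_trunc n z) (hasSum_coeff_trunc n z))) n
  rw [← pow_two, coeff_mk_mul_trunc_sq a hn] at h1
  have h2 := intervalIntegral.norm_integral_le_of_norm_le (μ := volume) Real.two_pi_pos.le
    (f := fun t : ℝ => F (Complex.exp (t * Complex.I)) *
      (sqrtTrinomialPoly n (Complex.exp (t * Complex.I)) *
        sqrtTrinomialPoly n (Complex.exp (t * Complex.I))) * Complex.exp (-n * (t * Complex.I)))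
    (g := fun t : ℝ => ‖sqrtTrinomialPoly n (Complex.exp (t * Complex.I))‖ ^ 2)
    (ae_of_all _ fun t _ => by
      have h1 : ‖Complex.exp (-n * (t * Complex.I))‖ = 1 := by
        have := Complex.norm_exp_ofReal_mul_I (-n * t)
        push_cast at this
        rw [← this]; congr 2; ring
      rw [norm_mul, h1, mul_one, norm_mul, norm_mul, ← pow_two]
      exact mul_le_of_le_one_left (by positivity) (hF _ (Complex.norm_exp_ofReal_mul_I t)))
    (Continuous.intervalIntegrable
      (by have := continuous_sqrtTrinomialPoly n; fun_prop) _ _)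
  rw [h1, integral_norm_sqrtTrinomialPoly_sq, norm_mul, norm_mul, Complex.norm_real,
    Real.norm_of_nonneg Real.pi_pos.le, Complex.norm_ofNat] at h2
  exact le_of_mul_le_mul_left h2 Real.two_pi_pos

theorem norm_le_one_of_diskSupNorm_le_one {f : ℂ → ℂ} (hf : diskSupNorm f ≤ 1) {z : ℂ}
    (hz : z ∈ ball (0 : ℂ) 1) : ‖f z‖ ≤ 1 := by
  have h : ‖f z‖ₑ ≤ 1 := (le_iSup₂ (f := fun z (_ : z ∈ ball (0 : ℂ) 1) => ‖f z‖ₑ) z hz).trans hf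
  rwa [← ofReal_norm, ENNReal.ofReal_le_one] at h

theorem diskSupNorm_le {f : ℂ → ℂ} {C : ℝ} (h : ∀ z ∈ ball (0 : ℂ) 1, ‖f z‖ ≤ C) :
    diskSupNorm f ≤ ENNReal.ofReal C := by
  refine iSup₂_le fun z hz => ?_
  rw [← ofReal_norm]
  exact ENNReal.ofReal_le_ofReal (h z hz)

/-- The value of the segment at `ζ` is the value at `1` of the segment of `z ↦ f (ζ z)`, which is
holomorphic across the unit circle. -/
theorem diskSupNorm_seriesSegment_le {f : ℂ → ℂ} {a : ℕ → ℂ} (ha : HasPowerSeriesOnDisk f a)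
    (hf : diskSupNorm f ≤ 1) {n : ℕ} (hn : 2 ≤ n) :
    diskSupNorm (seriesSegment a (n - 2) n) ≤
      ENNReal.ofReal (∑ k ∈ Finset.range (n + 1), sqrtTrinomialCoeff k ^ 2) := by
  refine diskSupNorm_le fun ζ hζ => ?_
  have hmem : ∀ z : ℂ, ‖z‖ = 1 → ζ * z ∈ ball (0 : ℂ) 1 := fun z hz => by
    rw [mem_ball_zero_iff, norm_mul, hz, mul_one]
    exact mem_ball_zero_iff.mp hζ
  have h := norm_seriesSegment_one_le (a := fun k => a k * ζ ^ k) (F := fun z => f (ζ * z))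
    (fun z hz => by simpa only [mul_pow, mul_assoc] using ha _ (hmem z hz))
    (fun z hz => norm_le_one_of_diskSupNorm_le_one hf (hmem z hz)) hn
  simpa only [seriesSegment, one_pow, mul_one] using h

/-! ### The sum of the squares of the coefficients -/

theorem abs_sqrtTrinomialCoeff_le (J : ℕ) :
    |sqrtTrinomialCoeff (3 * J + 1)| ≤ 8 * oneSubSqrtCoeff J ∧
    |sqrtTrinomialCoeff (3 * J + 2)| ≤ 8 * oneSubSqrtCoeff J ∧
    |sqrtTrinomialCoeff (3 * J + 3)| ≤ 8 * oneSubSqrtCoeff J := by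
  obtain ⟨hu, hv, -⟩ := sqrtTrinomialCoeff_sign J
  have h3 := sqrtTrinomialCoeff_three_mul_add_three_nonpos J
  have h := sqrtTrinomialCoeff_block_le J
  have hw := oneSubSqrtCoeff_pos J
  rw [abs_of_nonneg hu, abs_of_pos hv, abs_of_nonpos h3]
  refine ⟨?_, ?_, ?_⟩ <;> linarith

theorem summable_abs_sqrtTrinomialCoeff : Summable fun k => |sqrtTrinomialCoeff k| := by
  refine (summable_nat_add_iff 1).mp ?_
  have key : ∀ N, ∑ k ∈ Finset.range (3 * N), |sqrtTrinomialCoeff (k + 1)| ≤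
      24 * ∑ J ∈ Finset.range N, oneSubSqrtCoeff J := by
    intro N
    induction N with
    | zero => simp
    | succ N ih =>
      obtain ⟨h1, h2, h3⟩ := abs_sqrtTrinomialCoeff_le N
      rw [show 3 * (N + 1) = 3 * N + 1 + 1 + 1 by ring, Finset.sum_range_succ,
        Finset.sum_range_succ, Finset.sum_range_succ, Finset.sum_range_succ]
      rw [show 3 * N + 1 + 1 + 1 = 3 * N + 3 by ring, show 3 * N + 1 + 1 = 3 * N + 2 by ring]
      linarith
  refine summable_of_sum_range_le (c := 24 * ∑' J, oneSubSqrtCoeff J) (fun _ => abs_nonneg _)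
    fun N => ?_
  calc _ ≤ ∑ k ∈ Finset.range (3 * N), |sqrtTrinomialCoeff (k + 1)| :=
        Finset.sum_le_sum_of_subset_of_nonneg (Finset.range_mono (by omega))
          fun _ _ _ => abs_nonneg _
    _ ≤ _ := key N
    _ ≤ _ := by
        gcongr
        exact summable_oneSubSqrtCoeff.sum_le_tsum _ fun J _ => (oneSubSqrtCoeff_pos J).le

theorem integral_abs_one_add_two_cos :
    ∫ t in (0 : ℝ)..2 * Real.pi, |1 + 2 * Real.cos t| = 2 * Real.pi / 3 + 4 * Real.sqrt 3 := by
  have hpi := Real.pi_pos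
  have hc : Continuous fun t : ℝ => |1 + 2 * Real.cos t| := by fun_prop
  have hint : ∀ a b : ℝ, ∫ t in a..b, (1 + 2 * Real.cos t) =
      b - a + 2 * (Real.sin b - Real.sin a) := by
    intro a b
    rw [intervalIntegral.integral_add (by simp)
      (Continuous.intervalIntegrable (by fun_prop) _ _), intervalIntegral.integral_const_mul,
      integral_cos]
    simp
  have hs1 : Real.sin (2 * Real.pi / 3) = Real.sqrt 3 / 2 := by
    rw [show 2 * Real.pi / 3 = Real.pi - Real.pi / 3 by ring, Real.sin_pi_sub,
      Real.sin_pi_div_three]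
  have hs2 : Real.sin (4 * Real.pi / 3) = -(Real.sqrt 3 / 2) := by
    rw [show 4 * Real.pi / 3 = Real.pi / 3 + Real.pi by ring, Real.sin_add_pi,
      Real.sin_pi_div_three]
  have hc1 : Real.cos (2 * Real.pi / 3) = -(1 / 2) := by
    rw [show 2 * Real.pi / 3 = Real.pi - Real.pi / 3 by ring, Real.cos_pi_sub,
      Real.cos_pi_div_three]
  have i1 : ∫ t in (0 : ℝ)..2 * Real.pi / 3, |1 + 2 * Real.cos t| =
      2 * Real.pi / 3 + Real.sqrt 3 := by
    rw [intervalIntegral.integral_congr (g := fun t => 1 + 2 * Real.cos t), hint, hs1,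
      Real.sin_zero]
    · ring
    · intro t ht
      rw [Set.uIcc_of_le (by positivity)] at ht
      have := Real.cos_le_cos_of_nonneg_of_le_pi ht.1 (by linarith) ht.2
      exact abs_of_nonneg (by linarith)
  have i2 : ∫ t in (2 * Real.pi / 3)..(4 * Real.pi / 3), |1 + 2 * Real.cos t| =
      2 * Real.sqrt 3 - 2 * Real.pi / 3 := by
    rw [intervalIntegral.integral_congr (g := fun t => -(1 + 2 * Real.cos t)),
      intervalIntegral.integral_neg, hint, hs1, hs2]
    · ring
    · intro t ht
      rw [Set.uIcc_of_le (by linarith)] at ht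
      have h1 : |t - Real.pi| ≤ Real.pi / 3 := by
        rw [abs_le]; constructor <;> linarith [ht.1, ht.2]
      have h2 := Real.cos_le_cos_of_nonneg_of_le_pi (abs_nonneg _) (by linarith) h1
      rw [Real.cos_abs, Real.cos_sub_pi, Real.cos_pi_div_three] at h2
      exact abs_of_nonpos (by linarith)
  have i3 : ∫ t in (4 * Real.pi / 3)..(2 * Real.pi), |1 + 2 * Real.cos t| =
      2 * Real.pi / 3 + Real.sqrt 3 := by
    rw [intervalIntegral.integral_congr (g := fun t => 1 + 2 * Real.cos t), hint, hs2,
      Real.sin_two_pi]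
    · ring
    · intro t ht
      rw [Set.uIcc_of_le (by linarith)] at ht
      have := Real.cos_le_cos_of_nonneg_of_le_pi (x := 2 * Real.pi - t) (y := 2 * Real.pi / 3)
        (by linarith [ht.2]) (by linarith) (by linarith [ht.1])
      rw [Real.cos_two_pi_sub] at this
      exact abs_of_nonneg (by linarith)
  rw [← intervalIntegral.integral_add_adjacent_intervals (b := 4 * Real.pi / 3)
    (hc.intervalIntegrable _ _) (hc.intervalIntegrable _ _),
    ← intervalIntegral.integral_add_adjacent_intervals (b := 2 * Real.pi / 3)
    (hc.intervalIntegrable _ _) (hc.intervalIntegrable _ _), i1, i2, i3]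
  ring

theorem norm_one_add_exp_add_exp_sq (t : ℝ) :
    ‖1 + Complex.exp (t * Complex.I) + Complex.exp (t * Complex.I) ^ 2‖ =
      |1 + 2 * Real.cos t| := by
  have h : 1 + Complex.exp (t * Complex.I) + Complex.exp (t * Complex.I) ^ 2 =
      Complex.exp (t * Complex.I) * ((1 + 2 * Real.cos t : ℝ) : ℂ) := by
    have h1 : Complex.exp (t * Complex.I) * Complex.exp (-t * Complex.I) = 1 := by
      rw [← Complex.exp_add]; simp
    push_cast
    rw [Complex.cos]
    linear_combination (-1 : ℂ) * h1
  rw [h, norm_mul, Complex.norm_exp_ofReal_mul_I, one_mul, Complex.norm_real, Real.norm_eq_abs]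

/-- On the unit circle the partial sums converge to a square root of `1 + z + z²`. -/
theorem tendsto_norm_sqrtTrinomialPoly_sq {z : ℂ} (hz : ‖z‖ = 1) :
    Tendsto (fun N => ‖sqrtTrinomialPoly N z‖ ^ 2) atTop (𝓝 ‖1 + z + z ^ 2‖) := by
  have hs : Summable fun k =>
      coeff k (sqrtTrinomialSeries.map Complex.ofRealHom) * z ^ k := by
    refine Summable.of_norm_bounded summable_abs_sqrtTrinomialCoeff fun k => ?_
    rw [norm_mul, norm_pow, hz, one_pow, mul_one, coeff_map, Complex.ofRealHom_eq_coe,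
      Complex.norm_real, Real.norm_eq_abs, sqrtTrinomialSeries, coeff_mk]
  obtain ⟨g, hg⟩ := hs
  have hsq := hasSum_coeff_mul hg hg
  rw [← pow_two, ← map_pow, sqrtTrinomialSeries_sq] at hsq
  have h2 : HasSum (fun k => coeff k ((1 + X + X ^ 2 : PowerSeries ℝ).map Complex.ofRealHom) *
      z ^ k) (1 + z + z ^ 2) := by
    have := hasSum_coeff_polynomial (1 + Polynomial.X + Polynomial.X ^ 2) z
    simpa using this
  have h3 : ‖g‖ ^ 2 = ‖1 + z + z ^ 2‖ := by
    rw [← norm_pow, pow_two, hsq.unique h2]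
  rw [← h3]
  refine Tendsto.pow (Tendsto.norm ?_) 2
  have h4 := hg.tendsto_sum_nat.comp (tendsto_add_atTop_nat 1)
  refine h4.congr fun N => ?_
  simp [sqrtTrinomialPoly, sqrtTrinomialSeries]

theorem tendsto_sum_sqrtTrinomialCoeff_sq :
    Tendsto (fun N => ∑ k ∈ Finset.range (N + 1), sqrtTrinomialCoeff k ^ 2) atTop
      (𝓝 (1 / 3 + 2 * Real.sqrt 3 / Real.pi)) := by
  have hpi := Real.pi_pos
  set C := ∑' k, |sqrtTrinomialCoeff k|
  have hC : ∀ N (t : ℝ), ‖sqrtTrinomialPoly N (Complex.exp (t * Complex.I))‖ ≤ C := by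
    intro N t
    refine (norm_sum_le _ _).trans ?_
    refine le_trans (Finset.sum_le_sum fun k _ => ?_)
      (summable_abs_sqrtTrinomialCoeff.sum_le_tsum (Finset.range (N + 1)) fun _ _ => abs_nonneg _)
    rw [norm_mul, norm_pow, Complex.norm_exp_ofReal_mul_I, one_pow, mul_one, Complex.norm_real,
      Real.norm_eq_abs]
  have h := intervalIntegral.tendsto_integral_filter_of_dominated_convergence (μ := volume)
    (a := 0) (b := 2 * Real.pi) (l := atTop)
    (F := fun N (t : ℝ) => ‖sqrtTrinomialPoly N (Complex.exp (t * Complex.I))‖ ^ 2)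
    (f := fun t => |1 + 2 * Real.cos t|) (fun _ => C ^ 2)
    (Eventually.of_forall fun N => Continuous.aestronglyMeasurable
      (by have := continuous_sqrtTrinomialPoly N; fun_prop))
    (Eventually.of_forall fun N => ae_of_all _ fun t _ => by
      rw [norm_pow, norm_norm]
      exact pow_le_pow_left₀ (norm_nonneg _) (hC N t) 2)
    (by simp)
    (ae_of_all _ fun t _ => by
      rw [← norm_one_add_exp_add_exp_sq]
      exact tendsto_norm_sqrtTrinomialPoly_sq (Complex.norm_exp_ofReal_mul_I t))
  simp_rw [integral_norm_sqrtTrinomialPoly_sq] at h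
  rw [integral_abs_one_add_two_cos] at h
  have h2 := h.const_mul (2 * Real.pi)⁻¹
  convert! h2 using 2 with N
  · field_simp
  · field_simp
    ring

theorem sum_sqrtTrinomialCoeff_sq_lt (n : ℕ) :
    ∑ k ∈ Finset.range (n + 1), sqrtTrinomialCoeff k ^ 2 < 1 / 3 + 2 * Real.sqrt 3 / Real.pi := by
  have hmono : Monotone fun N => ∑ k ∈ Finset.range (N + 1), sqrtTrinomialCoeff k ^ 2 :=
    fun M N hMN => Finset.sum_le_sum_of_subset_of_nonneg (Finset.range_mono (by omega))
      fun _ _ _ => sq_nonneg _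
  -- a later coefficient that does not vanish
  have hpos := (sqrtTrinomialCoeff_sign n).2.1
  refine lt_of_lt_of_le ?_ (hmono.ge_of_tendsto tendsto_sum_sqrtTrinomialCoeff_sq (3 * n + 2))
  refine lt_of_le_of_lt (hmono (show n ≤ 3 * n + 1 by omega)) ?_
  simp only
  rw [Finset.sum_range_succ _ (3 * n + 1 + 1)]
  exact lt_add_of_pos_right _ (pow_pos hpos 2)

/-! ### The extremal function -/

theorem differentiableOn_extremalQuotient (n : ℕ) :
    DifferentiableOn ℂ (extremalQuotient n) (ball 0 1) := by
  intro z hz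
  refine (DifferentiableAt.div ?_ ?_ (sqrtTrinomialPoly_ne_zero n hz)).differentiableWithinAt
  · fun_prop
  · unfold sqrtTrinomialPoly
    fun_prop

/-- For the extremal function `f` one has `f T_n² = z ^ n T_n(1 / z) T_n(z)`; comparing the
coefficients of `z ^ n` evaluates the segment at `1`. -/
theorem seriesSegment_extremalQuotient_one {n : ℕ} (hn : 2 ≤ n) {a : ℕ → ℂ}
    (ha : HasPowerSeriesOnDisk (extremalQuotient n) a) : seriesSegment a (n - 2) n 1 =
      ((∑ k ∈ Finset.range (n + 1), sqrtTrinomialCoeff k ^ 2 : ℝ) : ℂ) := by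
  have ha' : HasPowerSeriesOnDisk (extremalQuotient n) fun k => coeff k (PowerSeries.mk a) := by
    simpa using ha
  have h1 := ha'.mul (g := sqrtTrinomialPoly n) fun z _ => hasSum_coeff_trunc n z
  have h2 : HasPowerSeriesOnDisk (fun z => extremalQuotient n z * sqrtTrinomialPoly n z)
      fun k => coeff k (reversedPoly n : PowerSeries ℂ) := by
    intro z hz
    have := hasSum_coeff_polynomial (reversedPoly n) z
    rw [eval_reversedPoly] at this
    simpa only [extremalQuotient, div_mul_cancel₀ _ (sqrtTrinomialPoly_ne_zero n hz)] using this
  have h3 : PowerSeries.mk a * (sqrtTrinomialTrunc n).map Complex.ofRealHom = reversedPoly n :=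
    PowerSeries.ext fun k => congrFun (h1.unique h2) k
  rw [← coeff_mk_mul_trunc_sq a hn, pow_two, ← mul_assoc, h3, mul_comm,
    coeff_trunc_mul_reversedPoly]

theorem norm_one_le_diskSupNorm {f : ℂ → ℂ} (hf : Continuous f) : ‖f 1‖ₑ ≤ diskSupNorm f := by
  have h1 : (1 : ℂ) ∈ closure (ball (0 : ℂ) 1) := by
    rw [closure_ball _ one_ne_zero]; simp
  have hcl : IsClosed {z : ℂ | ‖f z‖ₑ ≤ diskSupNorm f} :=
    isClosed_le (by fun_prop) continuous_const
  exact closure_minimal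
    (fun z hz => le_iSup₂ (f := fun z (_ : z ∈ ball (0 : ℂ) 1) => ‖f z‖ₑ) z hz) hcl h1

theorem mainTheorem1 :
    -- the numbers `b_k` are the coefficients of the principal branch of `√(1 + z + z²)`
    HasPowerSeriesOnDisk (fun z : ℂ => (1 + z + z ^ 2) ^ (1 / 2 : ℂ))
      (fun k : ℕ => (sqrtTrinomialCoeff k : ℂ)) ∧
    ∀ n : ℕ, 2 ≤ n →
      -- the bound for every bounded power series
      (∀ (f : ℂ → ℂ) (a : ℕ → ℂ), HasPowerSeriesOnDisk f a → diskSupNorm f ≤ 1 →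
        diskSupNorm (seriesSegment a (n - 2) n) ≤
          ENNReal.ofReal (∑ k ∈ Finset.range (n + 1), sqrtTrinomialCoeff k ^ 2)) ∧
      (∑ k ∈ Finset.range (n + 1), sqrtTrinomialCoeff k ^ 2
        < 1 / 3 + 2 * Real.sqrt 3 / Real.pi) ∧
      -- the extremal function is well defined, a Blaschke product, and attains equality
      (∀ z ∈ Metric.ball (0 : ℂ) 1, sqrtTrinomialPoly n z ≠ 0) ∧
      IsFiniteBlaschkeProduct (extremalQuotient n) ∧
      ∃ a : ℕ → ℂ, HasPowerSeriesOnDisk (extremalQuotient n) a ∧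
        diskSupNorm (extremalQuotient n) ≤ 1 ∧
        diskSupNorm (seriesSegment a (n - 2) n) =
          ENNReal.ofReal (∑ k ∈ Finset.range (n + 1), sqrtTrinomialCoeff k ^ 2) := by
  refine ⟨hasPowerSeriesOnDisk_sqrt_trinomial, fun n hn => ?_⟩
  have hB := isFiniteBlaschkeProduct_extremalQuotient n
  have ha := hasPowerSeriesOnDisk_taylor (differentiableOn_extremalQuotient n)
  have hle : diskSupNorm (extremalQuotient n) ≤ 1 := by
    simpa using diskSupNorm_le (C := 1) fun z hz => hB.norm_le_one hz
  refine ⟨fun f a hf hf1 => diskSupNorm_seriesSegment_le hf hf1 hn, sum_sqrtTrinomialCoeff_sq_lt n,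
    fun z hz => sqrtTrinomialPoly_ne_zero n hz, hB, _, ha, hle,
    (diskSupNorm_seriesSegment_le ha hle hn).antisymm ?_⟩
  have hcont : ∀ a : ℕ → ℂ, Continuous (seriesSegment a (n - 2) n) := fun a => by
    unfold seriesSegment
    fun_prop
  refine le_trans (le_of_eq ?_) (norm_one_le_diskSupNorm (hcont _))
  rw [seriesSegment_extremalQuotient_one hn ha, ← ofReal_norm, Complex.norm_real,
    Real.norm_of_nonneg (Finset.sum_nonneg fun _ _ => sq_nonneg _)]
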